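/- Let $(R,\mathfrak m,k)$ be a complete Noetherian local ring and let $E=E_R(k)$ be the injective hull of $k$; write $M^\vee=\operatorname{Hom}_R(M,E)$. Let $\alpha$ be a preradical on the class $\mathcal A$ of Artinian $R$-modules, i.e. an assignment of a submodule $\alpha(M)\subseteq M$ to each $M\in\mathcal A$ such that $g(\alpha(M))\subseteq\alpha(N)$ for every $R$-linear map $g\colon M\to N$ in $\mathcal A$. Its finitistic version is the preradical $\alpha_f(N)=\bigcup\{\alpha(M): M\subseteq N \text{ finitely generated}\}$. For a submodule $L\subseteq M$ with $M/L$ Artinian let $L\subseteq L^{\mathrm{cl}}_M\subseteq M$ and $L\subseteq L^{\mathrm{cl}_f}_M\subseteq M$ be the submodules with $L^{\mathrm{cl}}_M/L=\alpha(M/L)$ and $L^{\mathrm{cl}_f}_M/L=\alpha_f(M/L)$. Assume that $\mathrm{cl}$ and $\mathrm{cl}_f$ are closure operations, i.e. they are extensive, idempotent and order-preserving in $L$ for fixed $M$. For an ideal $I$ of $R$, the module $I^\vee$ is Artinian, and $\alpha^\smallsmile(I):=(I^\vee/\alpha(I^\vee))^\vee$, regarded as a submodule of $I^{\vee\vee}\cong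 I$; similarly for $(\alpha_f)^\smallsmile(I)$. Write $\operatorname{ann}_M(I)=\{x\in M: Ix=0\}$, $(J:K)=\{r\in R: rK\subseteq J\}$, and $\lambda$ for length. Then $E$ is Artinian and, for every ideal $I$ of $R$, $$\alpha^\smallsmile(I)=\operatorname{ann}_R\big((\operatorname{ann}_E(I))^{\mathrm{cl}}_E\big)=\bigcap_{M\in\mathcal A}\operatorname{ann}_R\big((\operatorname{ann}_M(I))^{\mathrm{cl}}_M\big)\subseteq(\alpha_f)^\smallsmile(I),$$ $$(\alpha_f)^\smallsmile(I)=\operatorname{ann}_R\big((\operatorname{ann}_E(I))^{\mathrm{cl}_f}_E\big)=\bigcap_{M\subseteq E\text{ f.g.}}\operatorname{ann}_R\big((\operatorname{ann}_M(I))^{\mathrm{cl}}_M\big)=\bigcap_{\lambda(M)<\infty}\operatorname{ann}_R\big((\operatorname{ann}_M(I))^{\mathrm{cl}}_M\big),$$ $$(\alpha_f)^\smallsmile(I)\subseteq\bigcap_{\lambda(R/J)<\infty}\operatorname{ann}_R\big((\operatorname{ann}_{R/J}(I))^{\mathrm{cl}}_{R/J}\big)=\bigcap_{\lambda(R/J)<\infty}\big(J:(J:I)^{\mathrm{cl}}_R\big).$$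 Moreover, suppose that $R$ is approximately Gorenstein, i.e. there is a decreasing sequence of $\mathfrak m$-primary ideals, cofinal with the powers of $\mathfrak m$, whose quotient rings are Gorenstein (have one-dimensional socle). Then the last containment is an equality, and for every decreasing sequence $\{J_t\}_{t\ge 0}$ of irreducible ideals that is cofinal with the powers of $\mathfrak m$ (every $\mathfrak m^n$ contains some $J_t$ and every $J_t$ contains some $\mathfrak m^n$), $$(\alpha_f)^\smallsmile(I)=\bigcap_{t\ge 0}\big(J_t:(J_t:I)^{\mathrm{cl}}_R\big).$$ -/

import Mathlib

universe u

/-- A submodule selector on the class of Artinian `R`-modules: it assigns to every Artinian module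
`M` a submodule of `M`, compatibly with isomorphisms. -/
structure ArtinianSelector (R : Type u) [CommRing R] where
  sel : ∀ (M : Type u) [AddCommGroup M] [Module R M] [IsArtinian R M], Submodule R M
  map_equiv : ∀ (M N : Type u) [AddCommGroup M] [Module R M] [IsArtinian R M]
    [AddCommGroup N] [Module R N] [IsArtinian R N] (e : M ≃ₗ[R] N),
    (sel M).map (e : M →ₗ[R] N) = sel N

/-- A functorial submodule selector (a preradical) on the class of Artinian `R`-modules. -/
structure ArtinianPreradical (R : Type u) [CommRing R] extends ArtinianSelector R where
  functorial : ∀ (M N : Type u) [AddCommGroup M] [Module R M] [IsArtinian R M]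
    [AddCommGroup N] [Module R N] [IsArtinian R N] (g : M →ₗ[R] N),
    (sel M).map g ≤ sel N

/-- For submodules `U ≤ V` of an Artinian module, a functorial selector maps the selected
submodule of `U` into the selected submodule of `V`. -/
theorem ArtinianPreradical.sel_le {R : Type u} [CommRing R] (α : ArtinianPreradical R)
    {M : Type u} [AddCommGroup M] [Module R M] [IsArtinian R M] {U V : Submodule R M}
    (h : U ≤ V) : (α.sel U).map U.subtype ≤ (α.sel V).map V.subtype := by
  rintro _ ⟨y, hy, rfl⟩
  exact ⟨Submodule.inclusion h y, α.functorial U V (Submodule.inclusion h) ⟨y, hy, rfl⟩, rfl⟩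

/-- The value at `N` of the finitistic version of `α`: the union of the submodules `α(M)`, where
`M` runs over the finitely generated submodules of `N`. -/
def ArtinianPreradical.finitisticSel {R : Type u} [CommRing R] (α : ArtinianPreradical R)
    (N : Type u) [AddCommGroup N] [Module R N] [IsArtinian R N] : Submodule R N where
  carrier := ⋃ (M : Submodule R N) (_ : M.FG), ((α.sel M).map M.subtype : Set N)
  zero_mem' := by
    simp only [Set.mem_iUnion]
    exact ⟨⊥, Submodule.fg_bot, Submodule.zero_mem _⟩
  add_mem' := by
    intro a b ha hb
    simp only [Set.mem_iUnion] at ha hb ⊢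
    obtain ⟨U, hU, ha⟩ := ha
    obtain ⟨V, hV, hb⟩ := hb
    exact ⟨U ⊔ V, hU.sup hV,
      Submodule.add_mem _ (α.sel_le le_sup_left ha) (α.sel_le le_sup_right hb)⟩
  smul_mem' := by
    intro r a ha
    simp only [Set.mem_iUnion] at ha ⊢
    obtain ⟨U, hU, ha⟩ := ha
    exact ⟨U, hU, Submodule.smul_mem _ r ha⟩

theorem ArtinianPreradical.finitisticSel_map_le {R : Type u} [CommRing R]
    (α : ArtinianPreradical R) (M N : Type u) [AddCommGroup M] [Module R M] [IsArtinian R M]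
    [AddCommGroup N] [Module R N] [IsArtinian R N] (g : M →ₗ[R] N) :
    (α.finitisticSel M).map g ≤ α.finitisticSel N := by
  rintro _ ⟨x, hx, rfl⟩
  change x ∈ ⋃ (U : Submodule R M) (_ : U.FG), ((α.sel U).map U.subtype : Set M) at hx
  change g x ∈ ⋃ (U : Submodule R N) (_ : U.FG), ((α.sel U).map U.subtype : Set N)
  simp only [Set.mem_iUnion] at hx ⊢
  obtain ⟨U, hU, y, hy, rfl⟩ := hx
  let g' : U →ₗ[R] U.map g := g.restrict fun z hz => Submodule.mem_map_of_mem hz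
  exact ⟨U.map g, hU.map g, g' y, α.functorial U (U.map g) g' ⟨y, hy, rfl⟩, rfl⟩

/-- The finitistic version `α_f` of a preradical `α`, again a preradical. -/
def ArtinianPreradical.finitistic {R : Type u} [CommRing R] (α : ArtinianPreradical R) :
    ArtinianPreradical R where
  sel := fun N _ _ _ => α.finitisticSel N
  map_equiv := by
    intro M N _ _ _ _ _ _ e
    refine le_antisymm (α.finitisticSel_map_le M N e) fun x hx => ?_
    exact ⟨e.symm x, α.finitisticSel_map_le N M e.symm ⟨x, hx, rfl⟩, by simp⟩
  functorial := fun M N _ _ _ _ _ _ g => α.finitisticSel_map_le M N g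

/-- The operation `cl` associated with a selector `α`: for a submodule `L` of `M` such that `M / L`
is Artinian, `L^cl_M` is the submodule of `M` containing `L` with `L^cl_M / L = α(M / L)`. -/
def ArtinianSelector.cl {R : Type u} [CommRing R] (α : ArtinianSelector R)
    {M : Type u} [AddCommGroup M] [Module R M] (L : Submodule R M) (h : IsArtinian R (M ⧸ L)) :
    Submodule R M :=
  (α.sel (M ⧸ L)).comap L.mkQ

/-- A closure operation, defined on the pairs `L ⊆ M` of `R`-modules with `M / L` Artinian:
extensive, idempotent, and order-preserving on submodules. -/
structure IsClosureOperation {R : Type u} [CommRing R]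
    (c : ∀ (M : Type u) [AddCommGroup M] [Module R M] (L : Submodule R M),
      IsArtinian R (M ⧸ L) → Submodule R M) : Prop where
  le_closure : ∀ (M : Type u) [AddCommGroup M] [Module R M] (L : Submodule R M)
    (h : IsArtinian R (M ⧸ L)), L ≤ c M L h
  idempotent : ∀ (M : Type u) [AddCommGroup M] [Module R M] (L : Submodule R M)
    (h : IsArtinian R (M ⧸ L)) (h' : IsArtinian R (M ⧸ c M L h)), c M (c M L h) h' = c M L h
  mono : ∀ (M : Type u) [AddCommGroup M] [Module R M] (L N : Submodule R M)
    (hL : IsArtinian R (M ⧸ L)) (hN : IsArtinian R (M ⧸ N)), L ≤ N → c M L hL ≤ c M N hN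

/-- The dual `α^⌣` of a selector `α` with respect to the Matlis duality `M^∨ = Hom_R(M, E)`:
`α^⌣(M) = (M^∨ / α(M^∨))^∨`, embedded in `M^∨^∨` by composition with `M^∨ → M^∨ / α(M^∨)`, and
regarded as a submodule of `M` through the evaluation map `M → M^∨^∨`. -/
def ArtinianSelector.smile {R : Type u} [CommRing R] (α : ArtinianSelector R)
    (E : Type u) [AddCommGroup E] [Module R E]
    (M : Type u) [AddCommGroup M] [Module R M] (h : IsArtinian R (M →ₗ[R] E)) :
    Submodule R M :=
  (LinearMap.range (LinearMap.lcomp R E (α.sel (M →ₗ[R] E)).mkQ)).comap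
    (LinearMap.applyₗ : M →ₗ[R] (M →ₗ[R] E) →ₗ[R] E)

/-- `α^⌣(I)` for an ideal `I`, as an ideal of `R` contained in `I`. -/
def ArtinianSelector.smileIdeal {R : Type u} [CommRing R] (α : ArtinianSelector R)
    (E : Type u) [AddCommGroup E] [Module R E] (I : Ideal R) (h : IsArtinian R (I →ₗ[R] E)) :
    Ideal R :=
  (α.smile E I h).map (Submodule.subtype I)

/-- `E` is an injective hull of `k`: an injective module that is an essential extension of (a copy
of) `k`. -/
def IsInjectiveHull (R : Type u) [CommRing R] (k : Type u) [AddCommGroup k] [Module R k]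
    (E : Type u) [AddCommGroup E] [Module R E] : Prop :=
  Module.Injective R E ∧ ∃ i : k →ₗ[R] E, Function.Injective i ∧
    ∀ N : Submodule R E, N ≠ ⊥ → LinearMap.range i ⊓ N ≠ ⊥

/-- The submodule `ann_M(I)` of the elements of `M` killed by the ideal `I`. -/
def annIn {R : Type u} [CommRing R] (M : Type u) [AddCommGroup M] [Module R M] (I : Ideal R) :
    Submodule R M :=
  Submodule.torsionBySet R M (I : Set R)

/-- The colon ideal `(J : K) = {r ∈ R | r K ⊆ J}`. -/
def idealColon {R : Type u} [CommRing R] (J K : Ideal R) : Ideal R :=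
  Submodule.colon J (K : Set R)

/-- The sequence of ideals `J` is cofinal with the powers of the maximal ideal. -/
def CofinalWithPowers {R : Type u} [CommRing R] [IsLocalRing R] (J : ℕ → Ideal R) : Prop :=
  (∀ n : ℕ, ∃ t, J t ≤ IsLocalRing.maximalIdeal R ^ n) ∧
    ∀ t, ∃ n : ℕ, IsLocalRing.maximalIdeal R ^ n ≤ J t

/-- `R` is approximately Gorenstein: there is a decreasing sequence of ideals `J t`, cofinal with
the powers of the maximal ideal, such that each (Artinian local) ring `R / J t` is Gorenstein, that
is, has a socle which is one-dimensional over (equivalently, isomorphic to) the residue field. -/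
def IsApproximatelyGorenstein (R : Type u) [CommRing R] [IsLocalRing R] : Prop :=
  ∃ J : ℕ → Ideal R, Antitone J ∧ CofinalWithPowers J ∧
    ∀ t, IsSimpleModule R (annIn (R ⧸ J t) (IsLocalRing.maximalIdeal R))

theorem isArtinian_quotient_mono {R : Type u} [CommRing R] {J K : Ideal R} (h : J ≤ K)
    (hJ : IsArtinian R (R ⧸ J)) : IsArtinian R (R ⧸ K) :=
  isArtinian_of_surjective (R ⧸ J) (Submodule.factor h) (Submodule.factor_surjective h)

theorem isArtinian_quotient_idealColon {R : Type u} [CommRing R] {J : Ideal R}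
    (hJ : IsArtinian R (R ⧸ J)) (I : Ideal R) : IsArtinian R (R ⧸ idealColon J I) :=
  isArtinian_quotient_mono Ideal.le_colon hJ

theorem isArtinian_of_isFiniteLength {R : Type u} [CommRing R] {M : Type u} [AddCommGroup M]
    [Module R M] (h : IsFiniteLength R M) : IsArtinian R M :=
  (isFiniteLength_iff_isNoetherian_isArtinian.mp h).2

theorem isArtinian_quotient_of_pow_le {R : Type u} [CommRing R] [IsLocalRing R]
    [IsNoetherianRing R] {J : Ideal R} {n : ℕ} (h : IsLocalRing.maximalIdeal R ^ n ≤ J) :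
    IsArtinian R (R ⧸ J) := by
  refine isArtinian_quotient_mono h ?_
  rcases Nat.eq_zero_or_pos n with rfl | hn
  · have : Subsingleton (R ⧸ IsLocalRing.maximalIdeal R ^ 0) :=
      Ideal.Quotient.subsingleton_iff.mpr (by simp)
    infer_instance
  · have hm : IsLocalRing.maximalIdeal R ∈ (IsLocalRing.maximalIdeal R ^ n).minimalPrimes :=
      ⟨⟨inferInstance, Ideal.pow_le_self hn.ne'⟩, fun q hq _ => hq.1.le_of_pow_le hq.2⟩
    have := IsLocalRing.quotient_artinian_of_mem_minimalPrimes_of_isLocalRing _ hm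
    exact isArtinian_of_surjective_algebraMap (M := R ⧸ IsLocalRing.maximalIdeal R ^ n)
      (S := R) (R := R ⧸ IsLocalRing.maximalIdeal R ^ n) Ideal.Quotient.mk_surjective

theorem CofinalWithPowers.isArtinian_quotient {R : Type u} [CommRing R] [IsLocalRing R]
    [IsNoetherianRing R] {J : ℕ → Ideal R} (hJ : CofinalWithPowers J) (t : ℕ) :
    IsArtinian R (R ⧸ J t) :=
  (hJ.2 t).elim fun _ h => isArtinian_quotient_of_pow_le h

/-- The ideal `(J : (J : I)^cl_R)`, for an ideal `J` of finite colength. -/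
def ArtinianSelector.colonClColon {R : Type u} [CommRing R] (α : ArtinianSelector R)
    (J I : Ideal R) (hJ : IsArtinian R (R ⧸ J)) : Ideal R :=
  idealColon J (α.cl (idealColon J I) (isArtinian_quotient_idealColon hJ I))

/-! By injectivity every map `I → E` is multiplication by an element of `E`, so `I^∨ ≅ E /
ann_E(I)`, and `α^⌣(I)` becomes the annihilator of `(ann_E(I))^cl` (`smileIdeal_eq`). Maps `g : M →
E` carry closures of `ann_M(I)` into closures of `ann_E(I)` and detect every nonzero `r • x`, so `E`
gives the smallest annihilator among all `M` (`annihilator_le`).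

For `α_f`, each element of the finitistic closure in `E` already lies in the closure inside some
finitely generated `M ⊆ E`. Such an `M` has finite length and is killed by a power of `𝔪`. If `J`
lies in that power and `R / J` has simple socle, then `R / J ≅ ann_E(J)`, so `M` embeds in `R / J`;
hence a cofinal sequence of such `J` computes `(α_f)^⌣(I)`.

Completeness enters through `End(E) = R`, which makes `E` Artinian and gives `R / J ≅ ann_E(J)`.
Simple socles are handled through a monolithic element, one lying in every nonzero submodule. -/

theorem mem_annIn {R : Type u} [CommRing R] {M : Type u} [AddCommGroup M] [Module R M]
    {I : Ideal R} {x : M} : x ∈ annIn M I ↔ ∀ r ∈ I, r • x = 0 := by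
  simp [annIn, Submodule.mem_torsionBySet_iff]

/-- A linear map into an injective module extends along any linear map whose kernel it kills. -/
theorem Module.Injective.exists_extend {R : Type u} [CommRing R] {E : Type u} [AddCommGroup E]
    [Module R E] (hE : Module.Injective R E) {X Y : Type u} [AddCommGroup X] [Module R X]
    [AddCommGroup Y] [Module R Y] (f : X →ₗ[R] Y) (g : X →ₗ[R] E)
    (hfg : LinearMap.ker f ≤ LinearMap.ker g) : ∃ h : Y →ₗ[R] E, ∀ x, h (f x) = g x := by
  obtain ⟨h, hh⟩ := hE.out ((LinearMap.ker f).liftQ f le_rfl)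
    (LinearMap.ker_eq_bot.mp (Submodule.ker_liftQ_eq_bot _ _ _ le_rfl))
    ((LinearMap.ker f).liftQ g hfg)
  exact ⟨h, fun x => by simpa using hh (Submodule.Quotient.mk x)⟩

/-- `x` is a nonzero element contained in every nonzero submodule of `M`. -/
def IsMonolithic (R : Type u) [CommRing R] {M : Type u} [AddCommGroup M] [Module R M] (x : M) :
    Prop :=
  x ≠ 0 ∧ ∀ N : Submodule R M, N ≠ ⊥ → x ∈ N

theorem IsMonolithic.exists_smul_eq {R : Type u} [CommRing R] {M : Type u} [AddCommGroup M]
    [Module R M] {x : M} (hx : IsMonolithic R x) {y : M} (hy : y ≠ 0) : ∃ c : R, c • y = x :=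
  Submodule.mem_span_singleton.mp (hx.2 (R ∙ y) (by simpa using hy))

theorem IsMonolithic.injective {R : Type u} [CommRing R] {M N : Type u} [AddCommGroup M]
    [Module R M] [AddCommGroup N] [Module R N] {x : M} (hx : IsMonolithic R x)
    (f : M →ₗ[R] N) (hf : f x ≠ 0) : Function.Injective f := by
  rw [← LinearMap.ker_eq_bot]
  by_contra h
  exact hf (hx.2 _ h)

theorem quotient_smul_eq_zero {R : Type u} [CommRing R] {J : Ideal R} {r : R} (hr : r ∈ J)
    (x : R ⧸ J) : r • x = 0 := by
  rw [Algebra.smul_def, Ideal.Quotient.algebraMap_eq, Ideal.Quotient.eq_zero_iff_mem.mpr hr,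
    zero_mul]

/-! ### The injective hull of the residue field and its endomorphisms. -/

section Local

variable {R : Type u} [CommRing R] [IsLocalRing R]

open IsLocalRing

/-- An injective module with a monolithic element killed by the maximal ideal. -/
structure IsHullAt (R : Type u) [CommRing R] [IsLocalRing R] {E : Type u} [AddCommGroup E]
    [Module R E] (e : E) : Prop where
  injective : Module.Injective R E
  monolithic : IsMonolithic R e
  smul_eq_zero : ∀ r ∈ maximalIdeal R, r • e = 0

/-- Since `k` is generated by any nonzero element, a submodule meeting the copy of `k` contains the
image of `1`; this image serves as `e`. -/
theorem IsInjectiveHull.exists_isHullAt {E : Type u} [AddCommGroup E] [Module R E]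
    (hE : IsInjectiveHull R (ResidueField R) E) : ∃ e : E, IsHullAt R e := by
  obtain ⟨hinj, i, hi, hess⟩ := hE
  have key : ∀ c : ResidueField R, ∃ r : R, c = r • (1 : ResidueField R) := fun c => by
    obtain ⟨r, rfl⟩ := residue_surjective c
    exact ⟨r, by rw [Algebra.smul_def, mul_one]; rfl⟩
  refine ⟨i 1, hinj, ⟨fun h => one_ne_zero (hi (h.trans i.map_zero.symm)), fun N hN => ?_⟩, ?_⟩
  · obtain ⟨_, ⟨⟨c, rfl⟩, hc⟩, hc0⟩ := Submodule.exists_mem_ne_zero_of_ne_bot (hess N hN)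
    have hc' : c ≠ 0 := fun h => hc0 (by rw [h, map_zero])
    obtain ⟨r, hr⟩ := key c⁻¹
    have : i 1 = r • i c := by
      rw [← map_smul, ← inv_mul_cancel₀ hc', hr, smul_mul_assoc, one_mul]
    rw [this]
    exact N.smul_mem r hc
  · intro r hr
    rw [← map_smul, Algebra.smul_def, mul_one]
    have : algebraMap R (ResidueField R) r = 0 := (residue_eq_zero_iff r).mpr hr
    rw [this, map_zero]

namespace IsHullAt

variable {E : Type u} [AddCommGroup E] [Module R E] {e : E}

/-- `E` is a cogenerator: no unit kills `x`, so `r • x ↦ r • e` is well defined on `R x` and extends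
to `M`. -/
theorem exists_ne_zero (hE : IsHullAt R e) {M : Type u} [AddCommGroup M] [Module R M] {x : M}
    (hx : x ≠ 0) : ∃ f : M →ₗ[R] E, f x ≠ 0 := by
  obtain ⟨h, hh⟩ := hE.injective.exists_extend (LinearMap.toSpanSingleton R M x)
    (LinearMap.toSpanSingleton R E e) (fun r hr => by
      simp only [LinearMap.mem_ker, LinearMap.toSpanSingleton_apply] at hr ⊢
      exact hE.smul_eq_zero r fun hu => hx ((hu.smul_eq_zero).mp hr))
  refine ⟨h, ?_⟩
  have := hh 1
  simp only [LinearMap.toSpanSingleton_apply, one_smul] at this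
  rw [this]
  exact hE.monolithic.1

theorem exists_eq_smul (hE : IsHullAt R e) {y : E} (hy : ∀ r ∈ maximalIdeal R, r • y = 0) :
    ∃ c : R, y = c • e := by
  by_cases h0 : y = 0
  · exact ⟨0, by simp [h0]⟩
  obtain ⟨c, hc⟩ := hE.monolithic.exists_smul_eq h0
  have hu : IsUnit c := by
    by_contra h
    exact hE.monolithic.1 (hc ▸ hy c h)
  obtain ⟨u, rfl⟩ := hu
  exact ⟨(↑u⁻¹ : R), by rw [← hc, smul_smul, Units.inv_mul, one_smul]⟩

/-- If no power of `𝔪` killed `y`, then `e` would lie in every `𝔪 ^ n y`, against Krull's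
intersection theorem for `R y`. -/
theorem exists_pow_smul_eq_zero [IsNoetherianRing R] (hE : IsHullAt R e) (y : E) :
    ∃ n : ℕ, ∀ r ∈ maximalIdeal R ^ n, r • y = 0 := by
  by_contra! h
  have hy : y ≠ 0 := by
    rintro rfl
    obtain ⟨r, -, hr⟩ := h 0
    exact hr (smul_zero r)
  have hmem : e ∈ R ∙ y := hE.monolithic.2 _ (by simpa using hy)
  have : (⟨e, hmem⟩ : R ∙ y) ∈ ⨅ n : ℕ, maximalIdeal R ^ n • (⊤ : Submodule R (R ∙ y)) := by
    rw [Submodule.mem_iInf]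
    intro n
    obtain ⟨r, hr, hry⟩ := h n
    obtain ⟨t, ht⟩ := hE.monolithic.exists_smul_eq hry
    have : (⟨e, hmem⟩ : R ∙ y) = (t * r) • ⟨y, Submodule.mem_span_singleton_self y⟩ :=
      Subtype.ext (by simp [← ht, mul_smul])
    rw [this]
    exact Submodule.smul_mem_smul (Ideal.mul_mem_left _ t hr) trivial
  rw [Ideal.iInf_pow_smul_eq_bot_of_isLocalRing _ (maximalIdeal.isMaximal R).ne_top,
    Submodule.mem_bot] at this
  exact hE.monolithic.1 (congrArg Subtype.val this)

/-- The annihilator of `ann_E(A)` is `A`. -/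
theorem annihilator_annIn (hE : IsHullAt R e) (A : Ideal R) : (annIn E A).annihilator = A := by
  refine le_antisymm (fun r hr => ?_) fun r hr => ?_
  · by_contra h
    have hx : (Ideal.Quotient.mk A r : R ⧸ A) ≠ 0 := by
      rwa [Ne, Ideal.Quotient.eq_zero_iff_mem]
    obtain ⟨f, hf⟩ := hE.exists_ne_zero hx
    apply hf
    have h1 : f 1 ∈ annIn E A := mem_annIn.mpr fun a ha => by
      rw [← map_smul, Algebra.smul_def, mul_one, Ideal.Quotient.algebraMap_eq,
        Ideal.Quotient.eq_zero_iff_mem.mpr ha, map_zero]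
    have := Submodule.mem_annihilator.mp hr _ h1
    rwa [← map_smul, Algebra.smul_def, mul_one] at this
  · exact Submodule.mem_annihilator.mpr fun y hy => mem_annIn.mp hy r hr

/-- On `ann_E(B)`, with `B` containing a power of the maximal ideal, an endomorphism of `E` is
multiplication by a ring element. -/
theorem exists_eq_smul_on_annIn [IsNoetherianRing R] (hE : IsHullAt R e) {n : ℕ} (B : Ideal R)
    (hB : maximalIdeal R ^ n ≤ B) (f : E →ₗ[R] E) : ∃ r : R, ∀ y ∈ annIn E B, f y = r • y := by
  -- Noetherian induction: `B` is enlarged by a socle element `s` of `R / B`.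
  induction B using IsNoetherian.induction with
  | _ B ih =>
  by_cases htop : B = ⊤
  · refine ⟨0, fun y hy => ?_⟩
    have : y = 0 := by simpa using mem_annIn.mp hy 1 (htop ▸ trivial)
    simp [this]
  obtain ⟨s, hsB, hs⟩ : ∃ s, s ∉ B ∧ ∀ t ∈ maximalIdeal R, t * s ∈ B := by
    classical
    have hex : ∃ n, maximalIdeal R ^ n ≤ B := ⟨n, hB⟩
    have hpos : Nat.find hex ≠ 0 := fun h0 => htop <| by
      simpa [h0] using Nat.find_spec hex
    obtain ⟨m, hm⟩ := Nat.exists_eq_succ_of_ne_zero hpos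
    have := Nat.find_min hex (m := m) (by omega)
    obtain ⟨s, hs, hsB⟩ := SetLike.not_le_iff_exists.mp this
    refine ⟨s, hsB, fun t ht => Nat.find_spec hex ?_⟩
    rw [hm, pow_succ']
    exact Ideal.mul_mem_mul ht hs
  have hlt : B < B ⊔ Ideal.span {s} := lt_of_le_of_ne le_sup_left fun h =>
    hsB (h ▸ Ideal.mem_sup_right (Ideal.mem_span_singleton_self s))
  obtain ⟨r, hr⟩ := ih _ hlt (hB.trans hlt.le)
  -- The elements of `ann_E(B)` killed by `s` form `ann_E(B + (s))`, where the induction hypothesis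
  -- applies.
  have hA : ∀ y ∈ annIn E B, s • y = 0 → f y = r • y := fun y hy hsy => hr y <| by
    refine mem_annIn.mpr fun a ha => ?_
    obtain ⟨b, hb, c, hc, rfl⟩ := Submodule.mem_sup.mp ha
    obtain ⟨d, rfl⟩ := Ideal.mem_span_singleton'.mp hc
    rw [add_smul, mem_annIn.mp hy b hb, mul_smul, hsy, smul_zero, add_zero]
  have hsoc : ∀ y ∈ annIn E B, ∀ t ∈ maximalIdeal R, t • s • y = 0 := fun y hy t ht => by
    rw [smul_smul]
    exact mem_annIn.mp hy _ (hs t ht)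
  by_cases hall : ∀ y ∈ annIn E B, s • y = 0
  · exact ⟨r, fun y hy => hA y hy (hall y hy)⟩
  push Not at hall
  obtain ⟨y₀, hy₀, hne⟩ := hall
  obtain ⟨u, hu⟩ := hE.monolithic.exists_smul_eq hne
  have hgen : ∀ z : E, (∀ t ∈ maximalIdeal R, t • z = 0) → ∃ c : R, z = c • s • y₀ := fun z hz => by
    obtain ⟨c, rfl⟩ := hE.exists_eq_smul hz
    exact ⟨c * u, by rw [mul_smul, hu]⟩
  -- The error `f y₀ - r • y₀` is a socle element because `𝔪 y₀` is killed by `s`. The socle is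
  -- generated by `s • y₀`, so adding `c₀ * s` to `r` corrects the value at `y₀` without changing it
  -- where `s` acts as zero. Every other `y` differs from a multiple of `y₀` by an element killed by
  -- `s`.
  obtain ⟨c₀, hc₀⟩ := hgen (f y₀ - r • y₀) fun t ht => by
    rw [smul_sub, ← map_smul, hA (t • y₀) ((annIn E B).smul_mem t hy₀)
      (by rw [smul_comm]; exact hsoc y₀ hy₀ t ht), smul_comm, sub_self]
  refine ⟨r + c₀ * s, fun y hy => ?_⟩
  obtain ⟨c, hc⟩ := hgen (s • y) (hsoc y hy)
  have h1 := hA (y - c • y₀) (Submodule.sub_mem _ hy ((annIn E B).smul_mem c hy₀))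
    (by rw [smul_sub, hc, smul_comm s c, sub_self])
  rw [map_sub, map_smul, sub_eq_iff_eq_add] at h1
  rw [h1, add_smul, mul_smul, hc, sub_eq_iff_eq_add.mp hc₀]
  module

/-- Over a complete local ring, every endomorphism of the injective hull of the residue field is
multiplication by a ring element. -/
theorem exists_forall_eq_smul [IsNoetherianRing R] [IsAdicComplete (maximalIdeal R) R]
    (hE : IsHullAt R e) (f : E →ₗ[R] E) : ∃ r : R, ∀ y, f y = r • y := by
  choose r hr using fun n : ℕ => hE.exists_eq_smul_on_annIn (maximalIdeal R ^ n) le_rfl f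
  -- The multipliers `r n` are Cauchy: `r m - r n` kills `ann_E(𝔪 ^ m)`, whose annihilator is `𝔪 ^
  -- m`.
  obtain ⟨L, hL⟩ := IsPrecomplete.prec (I := maximalIdeal R) (M := R) inferInstance (f := r)
    (fun {m n} hmn => by
      rw [SModEq.sub_mem, smul_eq_mul, Ideal.mul_top, ← hE.annihilator_annIn (maximalIdeal R ^ m),
        Submodule.mem_annihilator]
      intro y hy
      rw [sub_smul, ← hr m y hy, ← hr n y (mem_annIn.mpr fun a ha =>
        mem_annIn.mp hy a (Ideal.pow_le_pow_right hmn ha)), sub_self])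
  refine ⟨L, fun y => ?_⟩
  obtain ⟨n, hn⟩ := hE.exists_pow_smul_eq_zero y
  have h1 := hL n
  rw [SModEq.sub_mem, smul_eq_mul, Ideal.mul_top] at h1
  rw [hr n y (mem_annIn.mpr hn), ← sub_eq_zero, ← sub_smul]
  exact hn _ h1

/-- Taking annihilators strictly reverses inclusions into the Noetherian lattice of ideals: for `N <
P`, some endomorphism of `E` vanishes on `N` but not on `P`, and it is multiplication by an element
of `R`. -/
theorem isArtinian [IsNoetherianRing R] [IsAdicComplete (maximalIdeal R) R]
    (hE : IsHullAt R e) : IsArtinian R E := by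
  refine StrictAnti.wellFoundedLT (f := fun N : Submodule R E => N.annihilator) fun N P hNP => ?_
  refine lt_of_le_of_ne (Submodule.annihilator_mono hNP.le) fun h => ?_
  obtain ⟨x, hxP, hxN⟩ := SetLike.exists_of_lt hNP
  obtain ⟨g, hg⟩ := hE.exists_ne_zero (x := N.mkQ x) (by simpa using hxN)
  obtain ⟨r, hr⟩ := hE.exists_forall_eq_smul (g ∘ₗ N.mkQ)
  have hrN : r ∈ N.annihilator := Submodule.mem_annihilator.mpr fun y hy => by
    rw [← hr y]
    simp [(Submodule.Quotient.mk_eq_zero N).mpr hy]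
  apply hg
  have h' : P.annihilator = N.annihilator := h
  have := Submodule.mem_annihilator.mp (h' ▸ hrN : r ∈ P.annihilator) x hxP
  rwa [← hr x] at this

/-- If `R / J` has a monolithic element, then it embeds in `E` with image `ann_E(J)`. -/
theorem exists_embedding_of_isMonolithic [IsNoetherianRing R] [IsAdicComplete (maximalIdeal R) R]
    (hE : IsHullAt R e) {J : Ideal R} {x : R ⧸ J} (hx : IsMonolithic R x) :
    ∃ j : (R ⧸ J) →ₗ[R] E, Function.Injective j ∧ annIn E J ≤ LinearMap.range j := by
  obtain ⟨j, hj⟩ := hE.exists_ne_zero hx.1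
  have hinj := hx.injective j hj
  refine ⟨j, hinj, fun y hy => ?_⟩
  -- Extending `1 ↦ y` along `j` gives an endomorphism of `E` sending `j 1` to `y`; as it is
  -- multiplication by `s`, one gets `y = j (s • 1)`.
  obtain ⟨h, hh⟩ := hE.injective.exists_extend j
    (Submodule.liftQ J (LinearMap.toSpanSingleton R E y) fun r hr => by
      simpa using mem_annIn.mp hy r hr)
    (by rw [LinearMap.ker_eq_bot.mpr hinj]; exact bot_le)
  obtain ⟨s, hs⟩ := hE.exists_forall_eq_smul h
  refine ⟨s • 1, ?_⟩
  rw [map_smul, ← hs, hh]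
  exact (Submodule.liftQ_apply J _ 1).trans (by simp)

end IsHullAt

/-! ### Monolithic quotients from irreducible ideals and from simple socles. -/

theorem exists_socle_mem_of_pow_smul_eq_zero {M : Type u} [AddCommGroup M] [Module R M] {n : ℕ}
    (hn : ∀ r ∈ maximalIdeal R ^ n, ∀ x : M, r • x = 0) {N : Submodule R M} (hN : N ≠ ⊥) :
    ∃ y ∈ N, y ≠ 0 ∧ ∀ r ∈ maximalIdeal R, r • y = 0 := by
  classical
  obtain ⟨x, hxN, hx⟩ := Submodule.exists_mem_ne_zero_of_ne_bot hN
  -- With `k` minimal such that `𝔪 ^ k` kills `x`, a nonzero element of `𝔪 ^ (k - 1) x` lies in the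
  -- socle.
  have hex : ∃ k, ∀ r ∈ maximalIdeal R ^ k, r • x = 0 := ⟨n, fun r hr => hn r hr x⟩
  have hpos : Nat.find hex ≠ 0 := fun h0 => hx <| by
    simpa using Nat.find_spec hex 1 (by simp [h0])
  obtain ⟨m, hm⟩ := Nat.exists_eq_succ_of_ne_zero hpos
  have := Nat.find_min hex (m := m) (by omega)
  push Not at this
  obtain ⟨s, hs, hsx⟩ := this
  refine ⟨s • x, N.smul_mem s hxN, hsx, fun r hr => ?_⟩
  rw [smul_smul]
  refine Nat.find_spec hex _ ?_
  rw [hm, pow_succ']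
  exact Ideal.mul_mem_mul hr hs

/-- For a nonzero socle element `z`, a nonzero `N` with `N ⊓ R z = ⊥` would exhibit `J` as an
intersection of two larger ideals; and `R z` is simple. -/
theorem exists_isMonolithic_of_infIrred {J : Ideal R} {n : ℕ} (hn : maximalIdeal R ^ n ≤ J)
    (hJ : InfIrred J) : ∃ x : R ⧸ J, IsMonolithic R x := by
  have htop : J ≠ ⊤ := fun h => hJ.1 (h ▸ isMax_top)
  have : Nontrivial (R ⧸ J) := Ideal.Quotient.nontrivial_iff.mpr htop
  have hbot : Submodule.comap J.mkQ ⊥ = J := by rw [Submodule.comap_bot, Submodule.ker_mkQ]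
  have hinj := Submodule.comap_injective_of_surjective J.mkQ_surjective
  obtain ⟨z, -, hz, hmz⟩ := exists_socle_mem_of_pow_smul_eq_zero (M := R ⧸ J) (n := n)
    (fun r hr x => quotient_smul_eq_zero (hn hr) x) (N := ⊤) top_ne_bot
  refine ⟨z, hz, fun N hN => ?_⟩
  have hne : N ⊓ (R ∙ z) ≠ ⊥ := fun h => by
    have h' := congrArg (Submodule.comap J.mkQ) h
    rw [Submodule.comap_inf, hbot] at h'
    rcases hJ.2 h' with h1 | h1
    · exact hN (hinj (h1.trans hbot.symm))
    · exact hz (by simpa using hinj (h1.trans hbot.symm))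
  obtain ⟨w, ⟨hwN, hw⟩, hw0⟩ := Submodule.exists_mem_ne_zero_of_ne_bot hne
  obtain ⟨c, rfl⟩ := Submodule.mem_span_singleton.mp hw
  have hu : IsUnit c := by
    by_contra h
    exact hw0 (hmz c h)
  exact (N.smul_mem_iff_of_isUnit hu).mp hwN

/-- Every nonzero submodule contains a nonzero socle element, and that element generates the simple
socle. -/
theorem exists_isMonolithic_of_isSimpleModule_annIn {J : Ideal R} {n : ℕ}
    (hn : maximalIdeal R ^ n ≤ J) (hJ : IsSimpleModule R (annIn (R ⧸ J) (maximalIdeal R))) :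
    ∃ x : R ⧸ J, IsMonolithic R x := by
  have := hJ.nontrivial
  obtain ⟨z, hz⟩ := exists_ne (0 : annIn (R ⧸ J) (maximalIdeal R))
  refine ⟨z, by simpa using hz, fun N hN => ?_⟩
  obtain ⟨y, hyN, hy, hmy⟩ := exists_socle_mem_of_pow_smul_eq_zero
    (fun r hr x => quotient_smul_eq_zero (hn hr) x) hN
  have hspan := IsSimpleModule.span_singleton_eq_top R
    (m := (⟨y, mem_annIn.mpr hmy⟩ : annIn (R ⧸ J) (maximalIdeal R)))
    (fun h => hy (congrArg Subtype.val h))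
  obtain ⟨c, hc⟩ := Submodule.mem_span_singleton.mp
    (hspan ▸ Submodule.mem_top : z ∈ Submodule.span R _)
  rw [← hc]
  exact N.smul_mem c hyN

end Local

/-! ### Functoriality of closures and comparison with the finitistic version. -/

theorem map_mem_annIn {R : Type u} [CommRing R] {M N : Type u} [AddCommGroup M] [Module R M]
    [AddCommGroup N] [Module R N] (g : M →ₗ[R] N) {I : Ideal R} {x : M} (hx : x ∈ annIn M I) :
    g x ∈ annIn N I :=
  mem_annIn.mpr fun r hr => by rw [← map_smul, mem_annIn.mp hx r hr, map_zero]

namespace ArtinianPreradical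

variable {R : Type u} [CommRing R] (α : ArtinianPreradical R)

theorem map_mem_sel {M N : Type u} [AddCommGroup M] [Module R M] [IsArtinian R M]
    [AddCommGroup N] [Module R N] [IsArtinian R N] (g : M →ₗ[R] N) {x : M} (hx : x ∈ α.sel M) :
    g x ∈ α.sel N :=
  α.functorial M N g ⟨x, hx, rfl⟩

theorem mem_cl {M : Type u} [AddCommGroup M] [Module R M] {L : Submodule R M}
    {h : IsArtinian R (M ⧸ L)} {x : M} : x ∈ α.cl L h ↔ L.mkQ x ∈ α.sel (M ⧸ L) :=
  Iff.rfl

theorem map_mem_cl {M N : Type u} [AddCommGroup M] [Module R M] [AddCommGroup N] [Module R N]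
    {L : Submodule R M} {L' : Submodule R N} {h : IsArtinian R (M ⧸ L)}
    {h' : IsArtinian R (N ⧸ L')} (g : M →ₗ[R] N) (hg : L ≤ L'.comap g) {x : M}
    (hx : x ∈ α.cl L h) : g x ∈ α.cl L' h' :=
  α.map_mem_sel (L.mapQ L' g hg) hx

theorem le_cl {M : Type u} [AddCommGroup M] [Module R M] (L : Submodule R M)
    (h : IsArtinian R (M ⧸ L)) : L ≤ α.cl L h := fun x hx => by
  rw [mem_cl, Submodule.mkQ_apply, (Submodule.Quotient.mk_eq_zero L).mpr hx]
  exact Submodule.zero_mem _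

theorem mem_finitistic_sel {N : Type u} [AddCommGroup N] [Module R N] [IsArtinian R N] {x : N} :
    x ∈ α.finitistic.sel N ↔
      ∃ U : Submodule R N, U.FG ∧ ∃ y : U, y ∈ α.sel U ∧ (y : N) = x := by
  change x ∈ ⋃ (U : Submodule R N) (_ : U.FG), ((α.sel U).map U.subtype : Set N) ↔ _
  simp only [Set.mem_iUnion, exists_prop]
  rfl

theorem finitistic_sel_le (N : Type u) [AddCommGroup N] [Module R N] [IsArtinian R N] :
    α.finitistic.sel N ≤ α.sel N := fun x hx => by
  obtain ⟨U, -, y, hy, rfl⟩ := α.mem_finitistic_sel.mp hx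
  exact α.map_mem_sel U.subtype hy

/-- A finitely generated module is one of its own finitely generated submodules. -/
theorem sel_le_finitistic_sel (M : Type u) [AddCommGroup M] [Module R M] [IsArtinian R M]
    [Module.Finite R M] : α.sel M ≤ α.finitistic.sel M := fun x hx =>
  α.mem_finitistic_sel.mpr ⟨⊤, Module.Finite.fg_top, (Submodule.topEquiv (R := R)).symm x,
    α.map_mem_sel (Submodule.topEquiv (R := R) (M := M)).symm.toLinearMap hx, rfl⟩

variable {α}

theorem cl_le_finitistic_cl {M : Type u} [AddCommGroup M] [Module R M] [Module.Finite R M]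
    (L : Submodule R M) (h : IsArtinian R (M ⧸ L)) : α.cl L h ≤ α.finitistic.cl L h :=
  fun _ hx => α.sel_le_finitistic_sel (M ⧸ L) hx

theorem finitistic_cl_le {M : Type u} [AddCommGroup M] [Module R M] (L : Submodule R M)
    (h : IsArtinian R (M ⧸ L)) : α.finitistic.cl L h ≤ α.cl L h :=
  fun _ hx => α.finitistic_sel_le (M ⧸ L) hx

/-- An element of the finitistic closure of `ann_N(I)` lies in the closure of `ann_M(I)` for a
finitely generated submodule `M` of `N`. -/
theorem exists_fg_mem_cl_of_mem_finitistic_cl {N : Type u} [AddCommGroup N] [Module R N]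
    [IsArtinian R N] {I : Ideal R} {x : N}
    (hx : x ∈ α.finitistic.cl (annIn N I) inferInstance) :
    ∃ M : Submodule R N, M.FG ∧ ∃ y : M, (y : N) = x ∧ y ∈ α.cl (annIn M I) inferInstance := by
  obtain ⟨U, hU, y, hy, hyx⟩ := α.mem_finitistic_sel.mp hx
  obtain ⟨t, rfl⟩ := hU
  -- `M` is generated by lifts of the generators of `U`, together with `x` itself so that `x ∈ M`.
  let σ := Function.surjInv (annIn N I).mkQ_surjective
  let M : Submodule R N := Submodule.span R (σ '' t) ⊔ R ∙ x
  have hxM : x ∈ M := Submodule.mem_sup_right (Submodule.mem_span_singleton_self x)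
  let g : (M ⧸ annIn M I) →ₗ[R] (N ⧸ annIn N I) :=
    (annIn M I).mapQ (annIn N I) M.subtype fun z hz => map_mem_annIn M.subtype hz
  -- Injectivity holds because `ann_M(I) = M ∩ ann_N(I)`; hence `U` embeds in `M / ann_M(I)`, and
  -- functoriality transports `y` there.
  have hg : Function.Injective g := by
    rw [← LinearMap.ker_eq_bot, Submodule.ker_mapQ, eq_bot_iff, Submodule.map_le_iff_le_comap,
      Submodule.comap_bot, Submodule.ker_mkQ]
    intro z hz
    exact mem_annIn.mpr fun r hr => Subtype.ext (mem_annIn.mp hz r hr)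
  have hU : Submodule.span R (t : Set (N ⧸ annIn N I)) ≤ LinearMap.range g :=
    Submodule.span_le.mpr fun z hz =>
      ⟨(annIn M I).mkQ ⟨σ z, Submodule.mem_sup_left (Submodule.subset_span ⟨z, hz, rfl⟩)⟩,
        Function.surjInv_eq _ z⟩
  refine ⟨M, (Submodule.fg_span (t.finite_toSet.image σ)).sup (Submodule.fg_span_singleton x),
    ⟨x, hxM⟩, rfl, ?_⟩
  have h := α.map_mem_sel ((LinearEquiv.ofInjective g hg).symm.toLinearMap ∘ₗ
    Submodule.inclusion hU) hy
  have hx' : Submodule.inclusion hU y =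
      LinearEquiv.ofInjective g hg ((annIn M I).mkQ ⟨x, hxM⟩) := Subtype.ext hyx
  rwa [LinearMap.comp_apply, hx', LinearEquiv.coe_coe, LinearEquiv.symm_apply_apply] at h

/-- The ideal `(J : I)` is the preimage of `ann_{R/J}(I)`, so `R / (J : I)` and `(R / J) /
ann_{R/J}(I)` are identified by maps in both directions, and the closures correspond. -/
theorem annihilator_cl_annIn_quotient (J I : Ideal R) (hJ : IsArtinian R (R ⧸ J))
    (h : IsArtinian R ((R ⧸ J) ⧸ annIn (R ⧸ J) I)) :
    (α.cl (annIn (R ⧸ J) I) h).annihilator = α.colonClColon J I hJ := by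
  have hcomap : idealColon J I = (annIn (R ⧸ J) I).comap J.mkQ := by
    ext x
    rw [Submodule.mem_comap, mem_annIn]
    refine Submodule.mem_colon.trans (forall₂_congr fun r _ => ?_)
    rw [← map_smul, Submodule.mkQ_apply, Submodule.Quotient.mk_eq_zero, smul_eq_mul, smul_eq_mul,
      mul_comm]
  let φ : (R ⧸ J) →ₗ[R] (R ⧸ idealColon J I) := Submodule.factor Ideal.le_colon
  have hφ : annIn (R ⧸ J) I ≤ LinearMap.ker φ := by
    intro z hz
    obtain ⟨x, rfl⟩ := J.mkQ_surjective z
    exact (Submodule.Quotient.mk_eq_zero _).mpr (hcomap ▸ hz : x ∈ idealColon J I)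
  have := isArtinian_quotient_idealColon hJ I
  have key : ∀ x : R, x ∈ α.cl (idealColon J I) (isArtinian_quotient_idealColon hJ I) ↔
      J.mkQ x ∈ α.cl (annIn (R ⧸ J) I) h := fun x =>
    ⟨fun hx => α.map_mem_cl J.mkQ hcomap.le hx,
      fun hx => α.map_mem_sel ((annIn (R ⧸ J) I).liftQ φ hφ) hx⟩
  ext r
  refine Submodule.mem_annihilator.trans (Iff.trans ?_ Submodule.mem_colon.symm)
  constructor
  · intro hr x hx
    have := hr _ ((key x).mp hx)
    rwa [← map_smul, Submodule.mkQ_apply, Submodule.Quotient.mk_eq_zero] at this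
  · intro hr z hz
    obtain ⟨x, rfl⟩ := J.mkQ_surjective z
    rw [← map_smul, Submodule.mkQ_apply, Submodule.Quotient.mk_eq_zero]
    exact hr x ((key x).mpr hz)

end ArtinianPreradical

/-! ### Matlis duals of ideals and annihilators of closures. -/

/-- Multiplication `E → Hom_R(I, E)`, with kernel `ann_E(I)`. -/
def mulHom {R : Type u} [CommRing R] (E : Type u) [AddCommGroup E] [Module R E] (I : Ideal R) :
    E →ₗ[R] (I →ₗ[R] E) :=
  (LinearMap.lsmul R E ∘ₗ I.subtype).flip

theorem mulHom_apply {R E : Type u} [CommRing R] [AddCommGroup E] [Module R E]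
    (I : Ideal R) (y : E) (x : I) : mulHom E I y x = (x : R) • y := rfl

theorem ker_mulHom {R E : Type u} [CommRing R] [AddCommGroup E] [Module R E]
    (I : Ideal R) : LinearMap.ker (mulHom E I) = annIn E I := by
  ext y
  simp [LinearMap.ext_iff, mulHom_apply, mem_annIn]

theorem ArtinianPreradical.mem_smile_iff {R E : Type u} [CommRing R] [AddCommGroup E] [Module R E]
    {α : ArtinianPreradical R} {M : Type u} [AddCommGroup M] [Module R M]
    {h : IsArtinian R (M →ₗ[R] E)} {x : M} :
    x ∈ α.smile E M h ↔ ∀ f ∈ α.sel (M →ₗ[R] E), f x = 0 := by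
  constructor
  · rintro ⟨g, hg⟩ f hf
    have : f x = g ((α.sel (M →ₗ[R] E)).mkQ f) := (LinearMap.congr_fun hg f).symm
    rw [this, Submodule.mkQ_apply, (Submodule.Quotient.mk_eq_zero _).mpr hf, map_zero]
  · intro H
    exact ⟨(α.sel (M →ₗ[R] E)).liftQ (LinearMap.applyₗ x) H, LinearMap.ext fun f => rfl⟩

namespace IsHullAt

open IsLocalRing

variable {R : Type u} [CommRing R] [IsLocalRing R] {E : Type u} [AddCommGroup E] [Module R E]
  {e : E}

theorem exists_hom_eq_smul (hE : IsHullAt R e) {I : Ideal R} (f : I →ₗ[R] E) :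
    ∃ y : E, ∀ x : I, f x = (x : R) • y := by
  obtain ⟨h, hh⟩ := hE.injective.exists_extend I.subtype f
    (by rw [Submodule.ker_subtype]; exact bot_le)
  exact ⟨h 1, fun x => by rw [← hh, ← map_smul]; simp⟩

theorem mulHom_surjective (hE : IsHullAt R e) (I : Ideal R) :
    Function.Surjective (mulHom E I) := fun f => by
  obtain ⟨y, hy⟩ := hE.exists_hom_eq_smul f
  exact ⟨y, LinearMap.ext fun x => (hy x).symm⟩

/-- The isomorphism `E / ann_E(I) ≅ I^∨` matches the selected submodules, and evaluating
multiplication by `y` at `r` gives `r • y`. -/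
theorem smileIdeal_eq (hE : IsHullAt R e) (α : ArtinianPreradical R) (I : Ideal R)
    (h : IsArtinian R (I →ₗ[R] E)) (h' : IsArtinian R (E ⧸ annIn E I)) :
    α.smileIdeal E I h = (α.cl (annIn E I) h').annihilator := by
  let φ : (E ⧸ annIn E I) ≃ₗ[R] (I →ₗ[R] E) :=
    (Submodule.quotEquivOfEq _ _ (ker_mulHom I).symm).trans
      ((mulHom E I).quotKerEquivOfSurjective (hE.mulHom_surjective I))
  have hφ : ∀ y : E, φ ((annIn E I).mkQ y) = mulHom E I y := fun y => rfl
  ext r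
  constructor
  · rintro ⟨x, hx, rfl⟩
    refine Submodule.mem_annihilator.mpr fun y hy => ?_
    have := ArtinianPreradical.mem_smile_iff.mp hx _ (α.map_mem_sel φ.toLinearMap hy)
    exact this
  · intro hr
    -- The closure contains `ann_E(I)`, whose annihilator is `I`.
    have hrI : r ∈ I := by
      rw [← hE.annihilator_annIn I]
      exact Submodule.annihilator_mono (α.le_cl _ h') hr
    refine ⟨⟨r, hrI⟩, ArtinianPreradical.mem_smile_iff.mpr fun f hf => ?_, rfl⟩
    obtain ⟨y, rfl⟩ := hE.mulHom_surjective I f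
    refine Submodule.mem_annihilator.mp hr y ?_
    have := α.map_mem_sel φ.symm.toLinearMap hf
    rwa [← hφ, LinearEquiv.coe_coe, LinearEquiv.symm_apply_apply] at this

/-- If `r • x ≠ 0`, some `g : M → E` detects it, while `g x ∈ L` is killed by `r`. -/
theorem annihilator_le (hE : IsHullAt R e) {M : Type u} [AddCommGroup M] [Module R M]
    {L : Submodule R E} {P : Submodule R M} (h : ∀ g : M →ₗ[R] E, P ≤ L.comap g) :
    L.annihilator ≤ P.annihilator := fun r hr => Submodule.mem_annihilator.mpr fun x hx => by
  by_contra hne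
  obtain ⟨g, hg⟩ := hE.exists_ne_zero hne
  exact hg (by rw [map_smul]; exact Submodule.mem_annihilator.mp hr _ (h g hx))

theorem exists_pow_le_annihilator [IsNoetherianRing R] (hE : IsHullAt R e) {M : Submodule R E}
    (hM : M.FG) : ∃ n : ℕ, maximalIdeal R ^ n ≤ M.annihilator := by
  induction M, hM using Submodule.fg_induction with
  | singleton y =>
    obtain ⟨n, hn⟩ := hE.exists_pow_smul_eq_zero y
    exact ⟨n, fun r hr => (Submodule.mem_annihilator_span_singleton y r).mpr (hn r hr)⟩
  | sup M N _ _ hM hN =>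
    obtain ⟨m, hm⟩ := hM
    obtain ⟨n, hn⟩ := hN
    refine ⟨m + n, fun r hr => Submodule.mem_annihilator.mpr fun x hx => ?_⟩
    obtain ⟨y, hy, z, hz, rfl⟩ := Submodule.mem_sup.mp hx
    rw [smul_add, Submodule.mem_annihilator.mp (hm (Ideal.pow_le_pow_right (by omega) hr)) y hy,
      Submodule.mem_annihilator.mp (hn (Ideal.pow_le_pow_right (by omega) hr)) z hz, add_zero]

/-- A submodule killed by `J` lies in `ann_E(J)`, which the embedded copy of `R / J` contains. -/
theorem exists_injective_of_isMonolithic [IsNoetherianRing R] [IsAdicComplete (maximalIdeal R) R]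
    (hE : IsHullAt R e) {J : Ideal R} {x : R ⧸ J} (hx : IsMonolithic R x) {M : Submodule R E}
    (hM : J ≤ M.annihilator) : ∃ g : M →ₗ[R] R ⧸ J, Function.Injective g := by
  obtain ⟨j, hj, hrange⟩ := hE.exists_embedding_of_isMonolithic hx
  have hle : M ≤ LinearMap.range j := fun y hy => hrange <| mem_annIn.mpr fun r hr =>
    Submodule.mem_annihilator.mp (hM hr) y hy
  exact ⟨(LinearEquiv.ofInjective j hj).symm.toLinearMap ∘ₗ Submodule.inclusion hle,
    (LinearEquiv.ofInjective j hj).symm.injective.comp (Submodule.inclusion_injective hle)⟩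

end IsHullAt

/-! ### Assembly of the equalities and containments. -/

theorem mainTheorem5 (R : Type u) [CommRing R] [IsLocalRing R] [IsNoetherianRing R]
    [IsAdicComplete (IsLocalRing.maximalIdeal R) R]
    (E : Type u) [AddCommGroup E] [Module R E]
    (hE : IsInjectiveHull R (IsLocalRing.ResidueField R) E)
    (α : ArtinianPreradical R)
    (hcl : IsClosureOperation (fun _ _ _ L h => α.cl L h))
    (hclf : IsClosureOperation (fun _ _ _ L h => α.finitistic.cl L h))
    (I : Ideal R) :
    -- `E` and `Hom_R(I, E)` are Artinian, so that `α` is defined on them and on `E / ann_E(I)`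
    ∃ (_ : IsArtinian R E) (hI : IsArtinian R (I →ₗ[R] E)),
      α.smileIdeal E I hI = (α.cl (annIn E I) inferInstance).annihilator ∧
      α.smileIdeal E I hI =
        (⨅ (M : Type u) (_ : AddCommGroup M) (_ : Module R M) (_ : IsArtinian R M),
          (α.cl (annIn M I) inferInstance).annihilator) ∧
      α.smileIdeal E I hI ≤ α.finitistic.smileIdeal E I hI ∧
      α.finitistic.smileIdeal E I hI =
        (α.finitistic.cl (annIn E I) inferInstance).annihilator ∧
      α.finitistic.smileIdeal E I hI =
        (⨅ (M : Submodule R E) (_ : M.FG), (α.cl (annIn M I) inferInstance).annihilator) ∧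
      α.finitistic.smileIdeal E I hI =
        (⨅ (M : Type u) (_ : AddCommGroup M) (_ : Module R M) (hM : IsFiniteLength R M),
          (α.cl (annIn M I)
            (have := isArtinian_of_isFiniteLength hM; inferInstance)).annihilator) ∧
      α.finitistic.smileIdeal E I hI ≤
        (⨅ (J : Ideal R) (hJ : IsFiniteLength R (R ⧸ J)),
          (α.cl (annIn (R ⧸ J) I)
            (have := isArtinian_of_isFiniteLength hJ; inferInstance)).annihilator) ∧
      (⨅ (J : Ideal R) (hJ : IsFiniteLength R (R ⧸ J)),
          (α.cl (annIn (R ⧸ J) I)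
            (have := isArtinian_of_isFiniteLength hJ; inferInstance)).annihilator) =
        (⨅ (J : Ideal R) (hJ : IsFiniteLength R (R ⧸ J)),
          α.colonClColon J I (isArtinian_of_isFiniteLength hJ)) ∧
      (IsApproximatelyGorenstein R →
        α.finitistic.smileIdeal E I hI =
          (⨅ (J : Ideal R) (hJ : IsFiniteLength R (R ⧸ J)),
            α.colonClColon J I (isArtinian_of_isFiniteLength hJ)) ∧
        ∀ (J : ℕ → Ideal R), Antitone J → (∀ t, InfIrred (J t)) →
          ∀ hJ : CofinalWithPowers J,
            α.finitistic.smileIdeal E I hI =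
              ⨅ t : ℕ, α.colonClColon (J t) I (hJ.isArtinian_quotient t)) := by
  obtain ⟨e, he⟩ := hE.exists_isHullAt
  have hA : IsArtinian R E := he.isArtinian
  have hI : IsArtinian R (I →ₗ[R] E) :=
    isArtinian_of_surjective E (mulHom E I) (he.mulHom_surjective I)
  -- On a finite length module the closure lies in the finitistic closure, which every map to `E`
  -- respects.
  have hfin : ∀ (M : Type u) [AddCommGroup M] [Module R M] (hM : IsFiniteLength R M),
      α.finitistic.smileIdeal E I hI ≤ (α.cl (annIn M I)
        (have := isArtinian_of_isFiniteLength hM; inferInstance)).annihilator := by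
    intro M _ _ hM
    have := (isFiniteLength_iff_isNoetherian_isArtinian.mp hM).1
    have := isArtinian_of_isFiniteLength hM
    rw [he.smileIdeal_eq α.finitistic I hI inferInstance]
    exact he.annihilator_le fun g x hx => α.finitistic.map_mem_cl (h' := inferInstance) g
      (fun _ => map_mem_annIn g) (ArtinianPreradical.cl_le_finitistic_cl _ _ hx)
  have hfg : ∀ M : Submodule R E, M.FG → IsFiniteLength R M := fun M hM => by
    have := Module.Finite.of_fg hM
    exact isFiniteLength_iff_isNoetherian_isArtinian.mpr ⟨inferInstance, inferInstance⟩
  -- Finitely generated submodules of `E` suffice; this gives the reverse containments.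
  have hsub : ∀ {r : R}, (∀ (M : Submodule R E), M.FG →
      r ∈ (α.cl (annIn M I) inferInstance).annihilator) → r ∈ α.finitistic.smileIdeal E I hI := by
    intro r hr
    rw [he.smileIdeal_eq α.finitistic I hI inferInstance, Submodule.mem_annihilator]
    intro x hx
    obtain ⟨M, hM, y, rfl, hy⟩ := ArtinianPreradical.exists_fg_mem_cl_of_mem_finitistic_cl hx
    exact congrArg Subtype.val (Submodule.mem_annihilator.mp (hr M hM) y hy)
  have hcolon : ∀ (J : Ideal R) (hJ : IsArtinian R (R ⧸ J)),
      α.finitistic.smileIdeal E I hI ≤ α.colonClColon J I hJ := by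
    intro J hJ
    rw [← α.annihilator_cl_annIn_quotient J I hJ inferInstance]
    exact hfin (R ⧸ J) (isFiniteLength_iff_isNoetherian_isArtinian.mpr ⟨inferInstance, hJ⟩)
  -- Each finitely generated `M ⊆ E` embeds in some `R / J t`, so an element killing the closure
  -- there kills the closure in `M`.
  have hseq : ∀ (J : ℕ → Ideal R) (hJ : CofinalWithPowers J),
      (∀ t, ∃ x : R ⧸ J t, IsMonolithic R x) →
      (⨅ t, α.colonClColon (J t) I (hJ.isArtinian_quotient t)) ≤
        α.finitistic.smileIdeal E I hI := by
    intro J hJ hmono r hr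
    refine hsub fun M hM => ?_
    obtain ⟨n, hn⟩ := he.exists_pow_le_annihilator hM
    obtain ⟨t, ht⟩ := hJ.1 n
    obtain ⟨x, hx⟩ := hmono t
    obtain ⟨g, hg⟩ := he.exists_injective_of_isMonolithic hx (ht.trans hn)
    have := hJ.isArtinian_quotient t
    have hrt := (Submodule.mem_iInf _).mp hr t
    rw [← α.annihilator_cl_annIn_quotient (J t) I _ inferInstance] at hrt
    refine Submodule.mem_annihilator.mpr fun y hy => hg ?_
    rw [map_smul, map_zero]
    exact Submodule.mem_annihilator.mp hrt _ (α.map_mem_cl g (fun _ => map_mem_annIn g) hy)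
  have hall : α.smileIdeal E I hI = (α.cl (annIn E I) inferInstance).annihilator :=
    he.smileIdeal_eq α I hI inferInstance
  have hallf : α.finitistic.smileIdeal E I hI =
      (α.finitistic.cl (annIn E I) inferInstance).annihilator :=
    he.smileIdeal_eq α.finitistic I hI inferInstance
  refine ⟨hA, hI, hall, le_antisymm ?_ ?_, ?_, hallf, le_antisymm ?_ ?_, le_antisymm ?_ ?_, ?_, ?_,
    fun hG => ⟨le_antisymm ?_ ?_, fun J _ hirr hJ => le_antisymm ?_ ?_⟩⟩
  · rw [hall]
    exact le_iInf fun M => le_iInf fun _ => le_iInf fun _ => le_iInf fun _ =>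
      he.annihilator_le fun g _ hx => α.map_mem_cl g (fun _ => map_mem_annIn g) hx
  · rw [hall]
    exact iInf_le_of_le E <| iInf_le_of_le _ <| iInf_le_of_le _ <| iInf_le_of_le hA le_rfl
  · rw [hall, hallf]
    exact Submodule.annihilator_mono (ArtinianPreradical.finitistic_cl_le _ _)
  · exact le_iInf fun M => le_iInf fun hM => hfin M (hfg M hM)
  · exact fun r hr => hsub fun M hM => (Submodule.mem_iInf _).mp ((Submodule.mem_iInf _).mp hr M) hM
  · exact le_iInf fun M => le_iInf fun _ => le_iInf fun _ => le_iInf fun hM => hfin M hM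
  · intro r hr
    simp only [Submodule.mem_iInf] at hr
    exact hsub fun M hM => hr M _ _ (hfg M hM)
  · exact le_iInf fun J => le_iInf fun hJ => hfin (R ⧸ J) hJ
  · exact iInf_congr fun J => iInf_congr fun hJ => α.annihilator_cl_annIn_quotient J I _ _
  · exact le_iInf fun J => le_iInf fun hJ => hcolon J _
  · obtain ⟨J, -, hJ, hsimple⟩ := hG
    refine le_trans (le_iInf fun t => ?_) (hseq J hJ fun t => ?_)
    · have := hJ.isArtinian_quotient t
      exact iInf₂_le (J t) (isFiniteLength_iff_isNoetherian_isArtinian.mpr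
        ⟨inferInstance, inferInstance⟩)
    · obtain ⟨n, hn⟩ := hJ.2 t
      exact exists_isMonolithic_of_isSimpleModule_annIn hn (hsimple t)
  · exact le_iInf fun t => hcolon (J t) _
  · refine hseq J hJ fun t => ?_
    obtain ⟨n, hn⟩ := hJ.2 t
    exact exists_isMonolithic_of_infIrred hn (hirr t)
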